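/- Let $d,m$ be natural numbers, $\Psi_0\in\mathbb R^{m\times(d+m)}$ and $\Psi_1\in\mathbb R^{d\times(d+m)}$ with $\Sigma_0=\Psi_0\Psi_0^\top$ and $\Sigma_1=\Psi_1\Psi_1^\top$ positive definite. Let $r\ge 0$, $\delta=\mathrm{diag}(\delta^1,\dots,\delta^d)$ with all $\delta^i>0$, $\eta\in\mathbb R^m$, and $\alpha^i,\mu^i\in\mathbb R$ for $i\le d$. Put $$\beta=\Psi_1\Psi_0^\top\Sigma_0^{-1},\qquad \Sigma_2=\Sigma_1-\Psi_1\Psi_0^\top\beta^\top,\qquad \Sigma_3=\Sigma_1-\Psi_1\Psi_0^\top\beta^\top-\beta\Psi_0\Psi_1^\top+\beta\Sigma_0\beta^\top,$$ $\boldsymbol\mu=(\mu^i-r)_{i\le d}$ and $\theta^i=\bigl(-\alpha^i-\sum_{j}\beta^{ij}\eta^j+\mu^i\bigr)/\delta^i$. Let $\gamma<0$ and $T\in\mathbb R$, and consider on $(-\infty,T]$ the terminal value problems $$C'=-C\Bigl(\tfrac{2\gamma}{1-\gamma}\Sigma_2^\top\Sigma_1^{-1}\Sigma_2+2\Sigma_3\Bigr)C+C\Bigl(\tfrac{\gamma}{1-\gamma}\Sigma_2^\top\Sigma_1^{-1}\delta+\delta\Bigr)+\Bigl(\tfrac{\gamma}{1-\gamma}\Sigma_2^\top\Sigma_1^{-1}\delta+\delta\Bigr)^{\!\top}C-\tfrac{\gamma}{2(1-\gamma)}\delta\Sigma_1^{-1}\delta,\qquad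 C(T)=0,$$ $$b'=R_u(t)\,b-C\Bigl(\tfrac{2\gamma}{1-\gamma}\Sigma_2^\top\Sigma_1^{-1}\boldsymbol\mu+2\delta\theta\Bigr)+\tfrac{\gamma}{1-\gamma}\delta\Sigma_1^{-1}\boldsymbol\mu,\qquad b(T)=0,$$ for $C(t)\in\mathbb R^{d\times d}$ and $b(t)\in\mathbb R^d$, where the coefficient matrix of the homogeneous part of the second equation is $$R_u(t)=-C(t)\Bigl(\tfrac{2\gamma}{1-\gamma}\Sigma_2^\top\Sigma_1^{-1}\Sigma_2+2\Sigma_3\Bigr)+\tfrac{\gamma}{1-\gamma}\delta\Sigma_1^{-1}\Sigma_2+\delta .$$ These problems have a solution $(C,b)$ on $(-\infty,T]$, and for every solution $(C,b)$ on $(-\infty,T]$: 1. there is a finite $t^*\le T$ such that for all $t<t^*$ every complex eigenvalue of $R_u(t)$ has positive real part (in particular, every real eigenvalue is positive); 2. $b$ has a finite steady state: the limit $\lim_{t\to-\infty}b(t)$ exists in $\mathbb R^d$. -/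

import Mathlib

open Matrix Filter Topology

/-- Parameters of a market with `d` co-integrated stocks, `m` factors and `d + m` independent
driving Brownian motions, together with the standing assumptions of the model. -/
structure CointegratedMarket (d m : ℕ) where
  /-- interest rate -/
  r : ℝ
  /-- drifts of the factor returns -/
  eta : Fin m → ℝ
  /-- systemic returns of the stocks after controlling for the factors -/
  alpha : Fin d → ℝ
  /-- drift coefficients of the stock returns -/
  drift : Fin d → ℝ
  /-- mean reversion speeds of the spreads -/
  speed : Fin d → ℝ
  /-- diffusion coefficients of the factors -/
  Psi0 : Matrix (Fin m) (Fin (d + m)) ℝ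
  /-- diffusion coefficients of the stocks -/
  Psi1 : Matrix (Fin d) (Fin (d + m)) ℝ
  r_nonneg : 0 ≤ r
  speed_pos : ∀ i, 0 < speed i
  posDef0 : (Psi0 * Psi0ᵀ).PosDef
  posDef1 : (Psi1 * Psi1ᵀ).PosDef

namespace CointegratedMarket

variable {d m : ℕ} (M : CointegratedMarket d m)

/-- Diffusion matrix of the factors. -/
noncomputable def Sigma0 : Matrix (Fin m) (Fin m) ℝ := M.Psi0 * M.Psi0ᵀ

/-- Diffusion matrix of the stocks. -/
noncomputable def Sigma1 : Matrix (Fin d) (Fin d) ℝ := M.Psi1 * M.Psi1ᵀ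

/-- Factor loadings of the stocks. -/
noncomputable def beta : Matrix (Fin d) (Fin m) ℝ := M.Psi1 * M.Psi0ᵀ * M.Sigma0⁻¹

noncomputable def Sigma2 : Matrix (Fin d) (Fin d) ℝ :=
  M.Sigma1 - M.Psi1 * M.Psi0ᵀ * M.betaᵀ

/-- Diffusion matrix of the spreads. -/
noncomputable def Sigma3 : Matrix (Fin d) (Fin d) ℝ :=
  M.Sigma1 - M.Psi1 * M.Psi0ᵀ * M.betaᵀ - M.beta * M.Psi0 * M.Psi1ᵀ
    + M.beta * M.Sigma0 * M.betaᵀ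

/-- Diagonal matrix of the mean reversion speeds. -/
noncomputable def delta : Matrix (Fin d) (Fin d) ℝ := Matrix.diagonal M.speed

/-- Excess drifts of the stocks over the interest rate. -/
noncomputable def mu : Fin d → ℝ := fun i => M.drift i - M.r

/-- Stationary means of the spreads. -/
noncomputable def theta : Fin d → ℝ :=
  fun i => (-M.alpha i - ∑ j, M.beta i j * M.eta j + M.drift i) / M.speed i

/-- Right-hand side of the matrix Riccati equation, as a function of the value of `C`. -/
noncomputable def riccatiRHS (γ : ℝ) (C : Matrix (Fin d) (Fin d) ℝ) :
    Matrix (Fin d) (Fin d) ℝ :=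
  -(C * ((2 * γ / (1 - γ)) • (M.Sigma2ᵀ * M.Sigma1⁻¹ * M.Sigma2) + (2 : ℝ) • M.Sigma3) * C)
    + C * ((γ / (1 - γ)) • (M.Sigma2ᵀ * M.Sigma1⁻¹ * M.delta) + M.delta)
    + ((γ / (1 - γ)) • (M.Sigma2ᵀ * M.Sigma1⁻¹ * M.delta) + M.delta)ᵀ * C
    - (γ / (2 * (1 - γ))) • (M.delta * M.Sigma1⁻¹ * M.delta)

/-- Coefficient matrix of the homogeneous part of the linear equation for `b`, as a function of
the value of `C`. -/
noncomputable def coeffR (γ : ℝ) (C : Matrix (Fin d) (Fin d) ℝ) : Matrix (Fin d) (Fin d) ℝ :=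
  -(C * ((2 * γ / (1 - γ)) • (M.Sigma2ᵀ * M.Sigma1⁻¹ * M.Sigma2) + (2 : ℝ) • M.Sigma3))
    + ((γ / (1 - γ)) • (M.delta * M.Sigma1⁻¹ * M.Sigma2) + M.delta)

/-- Inhomogeneous part of the linear equation for `b`, as a function of the value of `C`. -/
noncomputable def forcing (γ : ℝ) (C : Matrix (Fin d) (Fin d) ℝ) : Fin d → ℝ :=
  -(C *ᵥ ((2 * γ / (1 - γ)) • ((M.Sigma2ᵀ * M.Sigma1⁻¹) *ᵥ M.mu)
      + (2 : ℝ) • (M.delta *ᵥ M.theta)))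
    + (γ / (1 - γ)) • ((M.delta * M.Sigma1⁻¹) *ᵥ M.mu)

/-- `C` and `b` solve the terminal value problems of the unconstrained problem on `(-∞, T]`.
The derivative at `T` is the one-sided one, and the values after `T` are irrelevant. -/
structure IsSolution (γ T : ℝ) (C : ℝ → Matrix (Fin d) (Fin d) ℝ) (b : ℝ → Fin d → ℝ) :
    Prop where
  terminal_C : C T = 0
  terminal_b : b T = 0
  ode_C : ∀ t ≤ T, ∀ i j,
    HasDerivWithinAt (fun s => C s i j) (M.riccatiRHS γ (C t) i j) (Set.Iic T) t
  ode_b : ∀ t ≤ T, ∀ i,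
    HasDerivWithinAt (fun s => b s i) ((M.coeffR γ (C t) *ᵥ b t + M.forcing γ (C t)) i)
      (Set.Iic T) t

end CointegratedMarket

/-- Every complex eigenvalue of the real matrix `A` has positive real part. -/
def AllEigenvaluesPositive {d : ℕ} (A : Matrix (Fin d) (Fin d) ℝ) : Prop :=
  ∀ z : ℂ, Module.End.HasEigenvalue (Matrix.toLin' (A.map Complex.ofReal)) z → 0 < z.re

/-! Set `s = T - t` and `Y = -C`. Then `Y' = P - Y A - Aᵀ Y - Y Q Y`, `Y 0 = 0`. Since `Σ₃ = Σ₂` and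
`0 ≤ Σ₂ ≤ Σ₁`, one has `Σ₂ Σ₁⁻¹ Σ₂ ≤ Σ₂`; with `-1 < γ/(1-γ) < 0` this gives `P > 0` and `Q ≥ 0`
(`isRiccatiCost`).

The linear Hamiltonian system for `(U, V)` linearizes the equation: `Y = V U⁻¹`, where `U` never
degenerates (`isUnit_left`). Moreover `Uᵀ Y' U` is constantly `P`, so `Y` increases
(`field_nonneg`). An `N` with `A + Q N = δ` exists, and completing the square at `N` bounds the
diagonal of `Y`, hence all of `Y` (`diag_le`). So `Y` tends to a stationary point `L`, which is
positive definite because `P` is (`exists_limit`).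

The coefficient matrix `R = Y Q + Aᵀ` tends to `R₀ = L Q + Aᵀ`, and the stationary equation reads
`R₀ L + (R₀ L)ᵀ = P + L Q L > 0`. Thus `L⁻¹` is a Lyapunov matrix for `R₀`, and for `R` at late `s`.
This gives the sign of the eigenvalues (`re_pos_of_hasEigenvalue`) and the convergence of `b`
(`exists_tendsto_of_linear_ode`). -/

/-! ### Entrywise calculus of matrix-valued functions. -/

/-- Entrywise derivative of a matrix-valued function within a set. -/
def HasMatDerivWithinAt {m n : Type*} (F : ℝ → Matrix m n ℝ) (F' : Matrix m n ℝ) (S : Set ℝ)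
    (t : ℝ) : Prop :=
  ∀ i j, HasDerivWithinAt (fun s => F s i j) (F' i j) S t

namespace HasMatDerivWithinAt

variable {l m n : Type*} {S S' : Set ℝ} {t : ℝ} {F G : ℝ → Matrix m n ℝ} {F' G' : Matrix m n ℝ}

theorem mono (h : HasMatDerivWithinAt F F' S t) (hS : S' ⊆ S) : HasMatDerivWithinAt F F' S' t :=
  fun i j => (h i j).mono hS

theorem congr_deriv (h : HasMatDerivWithinAt F F' S t) (e : F' = G') :
    HasMatDerivWithinAt F G' S t := e ▸ h

theorem const (A : Matrix m n ℝ) : HasMatDerivWithinAt (fun _ => A) 0 S t :=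
  fun i j => hasDerivWithinAt_const t S (A i j)

theorem sub (hF : HasMatDerivWithinAt F F' S t) (hG : HasMatDerivWithinAt G G' S t) :
    HasMatDerivWithinAt (fun s => F s - G s) (F' - G') S t :=
  fun i j => (hF i j).sub (hG i j)

theorem transpose (hF : HasMatDerivWithinAt F F' S t) :
    HasMatDerivWithinAt (fun s => (F s)ᵀ) F'ᵀ S t :=
  fun i j => hF j i

theorem mul [Fintype m] {E : ℝ → Matrix l m ℝ} {E' : Matrix l m ℝ}
    (hE : HasMatDerivWithinAt E E' S t) (hF : HasMatDerivWithinAt F F' S t) :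
    HasMatDerivWithinAt (fun s => E s * F s) (E' * F t + E t * F') S t := by
  intro i j
  simp only [Matrix.mul_apply, Matrix.add_apply, ← Finset.sum_add_distrib]
  exact HasDerivWithinAt.fun_sum fun k _ => (hE i k).mul (hF k j)

theorem const_mul [Fintype m] (A : Matrix l m ℝ) (hF : HasMatDerivWithinAt F F' S t) :
    HasMatDerivWithinAt (fun s => A * F s) (A * F') S t :=
  ((const A).mul hF).congr_deriv (by simp)

theorem mul_const [Fintype n] (hF : HasMatDerivWithinAt F F' S t) (A : Matrix n l ℝ) :
    HasMatDerivWithinAt (fun s => F s * A) (F' * A) S t :=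
  (hF.mul (const A)).congr_deriv (by simp)

theorem mulVec [Fintype n] {x : ℝ → n → ℝ} {x' : n → ℝ} (hF : HasMatDerivWithinAt F F' S t)
    (hx : ∀ i, HasDerivWithinAt (fun s => x s i) (x' i) S t) (i : m) :
    HasDerivWithinAt (fun s => (F s *ᵥ x s) i) ((F' *ᵥ x t + F t *ᵥ x') i) S t := by
  simp only [Matrix.mulVec, dotProduct, Pi.add_apply, ← Finset.sum_add_distrib]
  exact HasDerivWithinAt.fun_sum fun k _ => (hF i k).mul (hx k)

theorem mulVec_const [Fintype n] (hF : HasMatDerivWithinAt F F' S t) (x : n → ℝ) (i : m) :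
    HasDerivWithinAt (fun s => (F s *ᵥ x) i) ((F' *ᵥ x) i) S t := by
  simpa using hF.mulVec (x := fun _ => x) (x' := 0) (fun i => hasDerivWithinAt_const t S (x i)) i

theorem inv [Fintype n] [DecidableEq n] {U : ℝ → Matrix n n ℝ} {U' : Matrix n n ℝ}
    (hU : HasMatDerivWithinAt U U' S t) (hdet : IsUnit (U t)) :
    HasMatDerivWithinAt (fun s => (U s)⁻¹) (-((U t)⁻¹ * U' * (U t)⁻¹)) S t := by
  -- The norm is auxiliary: it only gives access to the derivative of inversion in a Banach algebra.
  let _ : NormedRing (Matrix n n ℝ) := Matrix.linftyOpNormedRing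
  let _ : NormedAlgebra ℝ (Matrix n n ℝ) := Matrix.linftyOpNormedAlgebra
  have h1 : HasDerivWithinAt U U' S t :=
    hasDerivWithinAt_pi.2 fun i => hasDerivWithinAt_pi.2 fun j => hU i j
  obtain ⟨u, hu⟩ := hdet
  have h2 := hasFDerivAt_ringInverse (𝕜 := ℝ) u
  rw [hu] at h2
  have h3 := h2.comp_hasDerivWithinAt t h1
  intro i j
  have h4 := hasDerivWithinAt_pi.1 (hasDerivWithinAt_pi.1 h3 i) j
  have e : ((u⁻¹ : (Matrix n n ℝ)ˣ) : Matrix n n ℝ) = (U t)⁻¹ := by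
    rw [← hu, Matrix.coe_units_inv]
  simpa [Function.comp_def, Matrix.nonsing_inv_eq_ringInverse, e] using h4

end HasMatDerivWithinAt

theorem hasDerivWithinAt_dotProduct {n : Type*} [Fintype n] {S : Set ℝ} {t : ℝ}
    {x y : ℝ → n → ℝ} {x' y' : n → ℝ}
    (hx : ∀ i, HasDerivWithinAt (fun s => x s i) (x' i) S t)
    (hy : ∀ i, HasDerivWithinAt (fun s => y s i) (y' i) S t) :
    HasDerivWithinAt (fun s => x s ⬝ᵥ y s) (x' ⬝ᵥ y t + x t ⬝ᵥ y') S t := by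
  simp only [dotProduct, ← Finset.sum_add_distrib]
  exact HasDerivWithinAt.fun_sum fun k _ => (hx k).mul (hy k)

/-- A matrix-valued function with vanishing derivative on `[0, ∞)` is constant there. -/
theorem eq_of_hasMatDerivWithinAt_zero {m n : Type*} {F : ℝ → Matrix m n ℝ}
    (hF : ∀ t, 0 ≤ t → HasMatDerivWithinAt F 0 (Set.Ici 0) t) {s : ℝ} (hs : 0 ≤ s) :
    F s = F 0 := by
  ext i j
  refine constant_of_has_deriv_right_zero (f := fun s => F s i j) (a := 0) (b := s)
    (fun t ht => ((hF t ht.1 i j).continuousWithinAt).mono Set.Icc_subset_Ici_self)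
    (fun t ht => (hF t ht.1 i j).mono (Set.Ici_subset_Ici.2 ht.1)) s ⟨hs, le_rfl⟩

/-! ### Differential inequalities and bounds for quadratic forms. -/

/-- Gronwall's inequality for a real function with `f' ≤ c f`. -/
theorem le_mul_exp_of_deriv_le {f f' : ℝ → ℝ} {a b c : ℝ} (hab : a ≤ b)
    (hf : ∀ s ∈ Set.Icc a b, HasDerivWithinAt f (f' s) (Set.Icc a b) s)
    (h : ∀ s ∈ Set.Icc a b, f' s ≤ c * f s) : f b ≤ f a * Real.exp (c * (b - a)) := by
  have hg : ∀ s ∈ Set.Icc a b, HasDerivWithinAt (fun s => f s * Real.exp (-(c * s)))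
      (f' s * Real.exp (-(c * s)) + f s * (Real.exp (-(c * s)) * (-(c * 1)))) (Set.Icc a b) s :=
    fun s hs => (hf s hs).mul (((hasDerivWithinAt_id s _).const_mul c).neg.exp)
  have hanti : AntitoneOn (fun s => f s * Real.exp (-(c * s))) (Set.Icc a b) := by
    refine antitoneOn_of_hasDerivWithinAt_nonpos (convex_Icc a b)
      (fun s hs => (hg s hs).continuousWithinAt)
      (fun s hs => (hg s (interior_subset hs)).mono interior_subset) fun s hs => ?_
    have h1 := h s (interior_subset hs)
    nlinarith [mul_le_mul_of_nonneg_right h1 (Real.exp_pos (-(c * s))).le]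
  have h2 : f b * Real.exp (-(c * b)) ≤ f a * Real.exp (-(c * a)) :=
    hanti ⟨le_rfl, hab⟩ ⟨hab, le_rfl⟩ hab
  have h3 := mul_le_mul_of_nonneg_right h2 (Real.exp_pos (c * b)).le
  rw [mul_assoc, mul_assoc, ← Real.exp_add, ← Real.exp_add] at h3
  rw [neg_add_cancel, Real.exp_zero, mul_one] at h3
  rwa [mul_sub, sub_eq_neg_add]

/-- A nonnegative function with `V' ≤ -c V + k`, `c > 0` and `k → 0`, tends to zero. -/
theorem tendsto_zero_of_deriv_le {V V' k : ℝ → ℝ} {c : ℝ} (hc : 0 < c) (hV0 : ∀ s, 0 ≤ V s)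
    (hV : ∀ s, 0 ≤ s → HasDerivWithinAt V (V' s) (Set.Ici 0) s)
    (hle : ∀ᶠ s in atTop, V' s ≤ -c * V s + k s) (hk : Tendsto k atTop (𝓝 0)) :
    Tendsto V atTop (𝓝 0) := by
  rw [Metric.tendsto_atTop]
  intro ε hε
  have hk' : ∀ᶠ s in atTop, k s < c * (ε / 2) := hk.eventually_lt_const (by positivity)
  obtain ⟨a₀, ha₀⟩ := eventually_atTop.1 (hle.and hk')
  set a := max a₀ 0
  have hlim : Tendsto (fun s => (V a - ε / 2) * Real.exp (-c * (s - a))) atTop (𝓝 0) := by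
    have h1 : Tendsto (fun s : ℝ => c * (s - a)) atTop atTop :=
      (tendsto_atTop_add_const_right atTop (-a) tendsto_id).const_mul_atTop hc
    simpa using (Real.tendsto_exp_neg_atTop_nhds_zero.comp h1).const_mul (V a - ε / 2)
  obtain ⟨b₀, hb₀⟩ := eventually_atTop.1 (hlim.eventually_lt_const (half_pos hε))
  refine ⟨max a b₀, fun b hb => ?_⟩
  have hab : a ≤ b := (le_max_left _ _).trans hb
  -- Once `k < c ε / 2`, the shifted function satisfies `(V - ε/2)' ≤ -c (V - ε/2)` and decays
  -- exponentially.
  have h2 := le_mul_exp_of_deriv_le (f := fun s => V s - ε / 2) (f' := V') (c := -c) hab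
    (fun s hs => ((hV s ((le_max_right _ _).trans hs.1)).sub_const _).mono
      fun t ht => (le_max_right _ _).trans ht.1)
    (fun s hs => by
      have := ha₀ s ((le_max_left _ _).trans hs.1)
      linarith [this.1, this.2])
  have h3 := hb₀ b ((le_max_right _ _).trans hb)
  rw [Real.dist_eq, sub_zero, abs_of_nonneg (hV0 b)]
  linarith

theorem abs_dotProduct_mulVec_le {n : Type*} [Fintype n] (H : Matrix n n ℝ) (x : n → ℝ) :
    |x ⬝ᵥ H *ᵥ x| ≤ (∑ i, ∑ j, |H i j|) * (x ⬝ᵥ x) := by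
  have hx : ∀ i, x i ^ 2 ≤ x ⬝ᵥ x := fun i => by
    rw [dotProduct, sq]
    exact Finset.single_le_sum (f := fun i => x i * x i) (fun i _ => mul_self_nonneg _)
      (Finset.mem_univ i)
  have e : x ⬝ᵥ H *ᵥ x = ∑ i, ∑ j, x i * (H i j * x j) := by
    simp only [dotProduct, mulVec, Finset.mul_sum]
  rw [e, Finset.sum_mul]
  simp only [Finset.sum_mul]
  refine (Finset.abs_sum_le_sum_abs _ _).trans (Finset.sum_le_sum fun i _ => ?_)
  refine (Finset.abs_sum_le_sum_abs _ _).trans (Finset.sum_le_sum fun j _ => ?_)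
  have h1 : |x i * (H i j * x j)| = |H i j| * (|x i| * |x j|) := by
    rw [abs_mul, abs_mul]; ring
  rw [h1]
  refine mul_le_mul_of_nonneg_left ?_ (abs_nonneg _)
  nlinarith [sq_nonneg (|x i| - |x j|), hx i, hx j, sq_abs (x i), sq_abs (x j)]

/-- If `H` tends to a matrix with positive quadratic form, then the quadratic forms are eventually
uniformly bounded below. -/
theorem exists_pos_eventually_le_dotProduct_mulVec {n ι : Type*} [Fintype n] {l : Filter ι}
    {H : ι → Matrix n n ℝ} {H₀ : Matrix n n ℝ} (hpos : ∀ x ≠ 0, 0 < x ⬝ᵥ H₀ *ᵥ x)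
    (hH : Tendsto H l (𝓝 H₀)) :
    ∃ c > 0, ∀ᶠ s in l, ∀ x, c * (x ⬝ᵥ x) ≤ x ⬝ᵥ H s *ᵥ x := by
  -- For the limit form, `c` is its minimum on the Euclidean unit sphere; half of it is then given
  -- up to the perturbation `H s - H₀`.
  obtain ⟨c, hc, hcx⟩ : ∃ c > 0, ∀ x, c * (x ⬝ᵥ x) ≤ x ⬝ᵥ H₀ *ᵥ x := by
    rcases isEmpty_or_nonempty n with hn | hn
    · exact ⟨1, one_pos, fun x => by simp [dotProduct]⟩
    · let K : Set (n → ℝ) := {x | x ⬝ᵥ x = 1}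
      have hcont : Continuous fun x : n → ℝ => x ⬝ᵥ H₀ *ᵥ x := by
        simp only [dotProduct, mulVec]; fun_prop
      have hcont1 : Continuous fun x : n → ℝ => x ⬝ᵥ x := by
        simp only [dotProduct]; fun_prop
      have hK : IsCompact K := by
        refine Metric.isCompact_of_isClosed_isBounded (isClosed_eq hcont1 continuous_const)
          ((Metric.isBounded_closedBall (x := (0 : n → ℝ)) (r := 1)).subset fun x hx => ?_)
        rw [mem_closedBall_zero_iff, pi_norm_le_iff_of_nonneg zero_le_one]
        intro i
        have h1 : x i * x i ≤ x ⬝ᵥ x := Finset.single_le_sum (f := fun i => x i * x i)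
          (fun i _ => mul_self_nonneg _) (Finset.mem_univ i)
        have h2 : x ⬝ᵥ x = 1 := hx
        rw [Real.norm_eq_abs]
        exact abs_le_one_iff_mul_self_le_one.2 (by linarith)
      classical
      have hne : K.Nonempty := ⟨Pi.single (Classical.arbitrary n) 1, by simp [K]⟩
      obtain ⟨y, hy, hmin⟩ := hK.exists_isMinOn hne hcont.continuousOn
      have hy0 : y ≠ 0 := by
        rintro rfl
        simp [K] at hy
      refine ⟨_, hpos y hy0, fun x => ?_⟩
      by_cases hx : x = 0
      · simp [hx]
      have hxx : 0 < x ⬝ᵥ x := by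
        have := dotProduct_star_self_pos_iff.2 hx
        simpa using this
      set r := Real.sqrt (x ⬝ᵥ x)
      have hr : 0 < r := Real.sqrt_pos.2 hxx
      have hr2 : r * r = x ⬝ᵥ x := Real.mul_self_sqrt hxx.le
      have h1 : r⁻¹ • x ∈ K := by
        simp only [K, Set.mem_ofPred_eq, smul_dotProduct, dotProduct_smul, smul_eq_mul, ← hr2]
        field_simp
      have h2 : y ⬝ᵥ H₀ *ᵥ y ≤ (r⁻¹ • x) ⬝ᵥ H₀ *ᵥ (r⁻¹ • x) := hmin h1
      rw [mulVec_smul, smul_dotProduct, dotProduct_smul, smul_eq_mul, smul_eq_mul] at h2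
      rw [← hr2]
      calc _ ≤ (r⁻¹ * (r⁻¹ * (x ⬝ᵥ H₀ *ᵥ x))) * (r * r) :=
            mul_le_mul_of_nonneg_right h2 (by positivity)
        _ = _ := by field_simp
  refine ⟨c / 2, half_pos hc, ?_⟩
  have hlim : Tendsto (fun s => ∑ i, ∑ j, |(H s - H₀) i j|) l (𝓝 0) := by
    have h1 : ∀ i j, Tendsto (fun s => |(H s - H₀) i j|) l (𝓝 0) := fun i j => by
      have h2 := (tendsto_pi_nhds.1 (tendsto_pi_nhds.1 hH i) j).sub_const (H₀ i j)
      simpa using h2.abs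
    simpa using tendsto_finsetSum Finset.univ fun i _ =>
      tendsto_finsetSum Finset.univ fun j _ => h1 i j
  filter_upwards [hlim.eventually_lt_const (half_pos hc)] with s hs x
  have h1 := abs_dotProduct_mulVec_le (H s - H₀) x
  have h2 : x ⬝ᵥ H s *ᵥ x = x ⬝ᵥ H₀ *ᵥ x + x ⬝ᵥ (H s - H₀) *ᵥ x := by
    rw [← dotProduct_add, ← add_mulVec, add_sub_cancel]
  have hxx : 0 ≤ x ⬝ᵥ x := Finset.sum_nonneg fun i _ => mul_self_nonneg _
  have h3 := mul_le_mul_of_nonneg_right hs.le hxx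
  have h4 := neg_abs_le (x ⬝ᵥ (H s - H₀) *ᵥ x)
  linarith [hcx x]

/-! ### The Hamiltonian system behind the Riccati equation. -/

/-- Right-hand side of the matrix Riccati equation `Y' = P - Y A - Aᵀ Y - Y Q Y`. -/
def riccatiField {n : Type*} [Fintype n] (P Q A Y : Matrix n n ℝ) : Matrix n n ℝ :=
  P - Y * A - Aᵀ * Y - Y * Q * Y

/-- `(U, V)` is the solution of the linear Hamiltonian system attached to the matrix Riccati
equation, started at `(1, 0)`. -/
structure IsHamiltonianFlow {n : Type*} [Fintype n] [DecidableEq n] (P Q A : Matrix n n ℝ)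
    (U V : ℝ → Matrix n n ℝ) : Prop where
  left_zero : U 0 = 1
  right_zero : V 0 = 0
  deriv_left_univ : ∀ s, HasMatDerivWithinAt U (A * U s + Q * V s) Set.univ s
  deriv_right_univ : ∀ s, HasMatDerivWithinAt V (P * U s - Aᵀ * V s) Set.univ s

theorem exists_isHamiltonianFlow {n : Type*} [Fintype n] [DecidableEq n] (P Q A : Matrix n n ℝ) :
    ∃ U V : ℝ → Matrix n n ℝ, IsHamiltonianFlow P Q A U V := by
  let H : Matrix (n ⊕ n) (n ⊕ n) ℝ := fromBlocks A Q P (-Aᵀ)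
  let E : ℝ → Matrix (n ⊕ n) (n ⊕ n) ℝ := fun s => NormedSpace.exp (s • H)
  have hE : ∀ s i j, HasDerivWithinAt (fun s => E s i j) ((H * E s) i j) Set.univ s := by
    intro s i j
    let _ : NormedRing (Matrix (n ⊕ n) (n ⊕ n) ℝ) := Matrix.linftyOpNormedRing
    let _ : NormedAlgebra ℝ (Matrix (n ⊕ n) (n ⊕ n) ℝ) := Matrix.linftyOpNormedAlgebra
    have h1 := (hasDerivAt_exp_smul_const' (𝕂 := ℝ) H s).hasDerivWithinAt (s := Set.univ)
    exact hasDerivWithinAt_pi.1 (hasDerivWithinAt_pi.1 h1 i) j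
  have hE0 : E 0 = 1 := by simp [E]
  refine ⟨fun s => (E s).toBlocks₁₁, fun s => (E s).toBlocks₂₁, ?_, ?_, fun s i j => ?_,
    fun s i j => ?_⟩
  · rw [hE0, ← fromBlocks_one, toBlocks_fromBlocks₁₁]
  · rw [hE0, ← fromBlocks_one, toBlocks_fromBlocks₂₁]
  · refine (hE s (Sum.inl i) (Sum.inl j)).congr_deriv ?_
    simp [H, Matrix.mul_apply, Fintype.sum_sum_type, toBlocks₁₁, toBlocks₂₁]
  · refine (hE s (Sum.inr i) (Sum.inl j)).congr_deriv ?_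
    simp [H, Matrix.mul_apply, Fintype.sum_sum_type, toBlocks₁₁, toBlocks₂₁, sub_eq_add_neg]

theorem continuousOn_of_hasMatDerivWithinAt {n : Type*} {F F' : ℝ → Matrix n n ℝ} {S : Set ℝ}
    (h : ∀ s ∈ S, HasMatDerivWithinAt F (F' s) S s) : ContinuousOn F S :=
  continuousOn_pi.2 fun i => continuousOn_pi.2 fun j => fun s hs => (h s hs i j).continuousWithinAt

section Riccati

variable {n : Type*} [Fintype n] {P Q A : Matrix n n ℝ}

/-- A solution of a linear system `e' = -R e` that vanishes at `0` vanishes on `[0, ∞)`. -/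
theorem eq_zero_of_linear_ode {R : ℝ → Matrix n n ℝ} (hR : ContinuousOn R (Set.Ici 0))
    {e : ℝ → n → ℝ} (he0 : e 0 = 0)
    (he : ∀ s, 0 ≤ s → ∀ i, HasDerivWithinAt (fun s => e s i) (-(R s *ᵥ e s) i) (Set.Ici 0) s)
    {s : ℝ} (hs : 0 ≤ s) : e s = 0 := by
  have hb : ContinuousOn (fun s => ∑ i, ∑ j, |R s i j|) (Set.Icc 0 s) := by
    refine continuousOn_finsetSum _ fun i _ => continuousOn_finsetSum _ fun j _ => ?_
    exact ((continuousOn_pi.1 (continuousOn_pi.1 hR i) j).mono Set.Icc_subset_Ici_self).abs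
  obtain ⟨K, hK⟩ := isCompact_Icc.bddAbove_image hb
  have h1 := le_mul_exp_of_deriv_le (f := fun s => e s ⬝ᵥ e s)
    (f' := fun s => -(R s *ᵥ e s) ⬝ᵥ e s + e s ⬝ᵥ -(R s *ᵥ e s)) (c := 2 * K) hs
    (fun t ht => (hasDerivWithinAt_dotProduct (fun i => he t ht.1 i)
      (fun i => he t ht.1 i)).mono Set.Icc_subset_Ici_self)
    (fun t ht => by
      have h2 : ∑ i, ∑ j, |R t i j| ≤ K := hK (Set.mem_image_of_mem _ ht)
      have h3 := abs_dotProduct_mulVec_le (R t) (e t)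
      have h4 : 0 ≤ e t ⬝ᵥ e t := Finset.sum_nonneg fun i _ => mul_self_nonneg _
      have h5 := mul_le_mul_of_nonneg_right h2 h4
      have h6 := neg_abs_le (e t ⬝ᵥ R t *ᵥ e t)
      rw [neg_dotProduct, dotProduct_neg, dotProduct_comm (R t *ᵥ e t)]
      linarith)
  simp only [he0, zero_dotProduct, zero_mul] at h1
  have h4 : 0 ≤ e s ⬝ᵥ e s := Finset.sum_nonneg fun i _ => mul_self_nonneg _
  exact dotProduct_self_eq_zero.1 (le_antisymm h1 h4)

variable [DecidableEq n]

namespace IsHamiltonianFlow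

variable {U V : ℝ → Matrix n n ℝ} (h : IsHamiltonianFlow P Q A U V)
include h

theorem deriv_left (s : ℝ) : HasMatDerivWithinAt U (A * U s + Q * V s) (Set.Ici 0) s :=
  (h.deriv_left_univ s).mono (Set.subset_univ _)

theorem deriv_right (s : ℝ) : HasMatDerivWithinAt V (P * U s - Aᵀ * V s) (Set.Ici 0) s :=
  (h.deriv_right_univ s).mono (Set.subset_univ _)

theorem continuous_left : Continuous U :=
  continuousOn_univ.1 (continuousOn_of_hasMatDerivWithinAt fun s _ => h.deriv_left_univ s)

theorem continuous_right : Continuous V :=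
  continuousOn_univ.1 (continuousOn_of_hasMatDerivWithinAt fun s _ => h.deriv_right_univ s)

theorem hasMatDerivWithinAt_transpose_mul (hQ : Qᵀ = Q) (s : ℝ) :
    HasMatDerivWithinAt (fun s => (U s)ᵀ * V s) ((V s)ᵀ * Q * V s + (U s)ᵀ * P * U s)
      (Set.Ici 0) s := by
  refine ((h.deriv_left s).transpose.mul (h.deriv_right s)).congr_deriv ?_
  simp only [transpose_add, transpose_mul, hQ]
  noncomm_ring

/-- The antisymmetric part of `Uᵀ V` is conserved and starts at zero. This is the source of the
symmetry of `Y`. -/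
theorem transpose_mul_eq (hP : Pᵀ = P) (hQ : Qᵀ = Q) {s : ℝ} (hs : 0 ≤ s) :
    (U s)ᵀ * V s = (V s)ᵀ * U s := by
  have h1 := eq_of_hasMatDerivWithinAt_zero (F := fun s => (U s)ᵀ * V s - ((U s)ᵀ * V s)ᵀ)
    (fun t _ => ((h.hasMatDerivWithinAt_transpose_mul hQ t).sub
      (h.hasMatDerivWithinAt_transpose_mul hQ t).transpose).congr_deriv (by
        simp only [transpose_add, transpose_mul, hP, hQ, transpose_transpose]
        noncomm_ring)) hs
  simpa [h.right_zero, sub_eq_zero] using h1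

theorem hasDerivWithinAt_quadratic (hQ : Qᵀ = Q) (x : n → ℝ) (s : ℝ) :
    HasDerivWithinAt (fun s => x ⬝ᵥ ((U s)ᵀ * V s) *ᵥ x)
      ((V s *ᵥ x) ⬝ᵥ Q *ᵥ (V s *ᵥ x) + (U s *ᵥ x) ⬝ᵥ P *ᵥ (U s *ᵥ x)) (Set.Ici 0) s := by
  have h1 := hasDerivWithinAt_dotProduct (x := fun _ => x) (x' := 0)
    (fun i => hasDerivWithinAt_const s (Set.Ici (0 : ℝ)) (x i))
    ((h.hasMatDerivWithinAt_transpose_mul hQ s).mulVec_const x)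
  refine h1.congr_deriv ?_
  rw [zero_dotProduct, zero_add, add_mulVec, dotProduct_add]
  congr 1 <;>
  · rw [← mulVec_mulVec, ← mulVec_mulVec, dotProduct_mulVec, vecMul_transpose]

theorem monotoneOn_quadratic (hQ : Qᵀ = Q) (hQ0 : ∀ x, 0 ≤ x ⬝ᵥ Q *ᵥ x)
    (hP0 : ∀ x ≠ 0, 0 < x ⬝ᵥ P *ᵥ x) (x : n → ℝ) :
    MonotoneOn (fun s => x ⬝ᵥ ((U s)ᵀ * V s) *ᵥ x) (Set.Ici 0) := by
  refine monotoneOn_of_hasDerivWithinAt_nonneg (convex_Ici 0)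
    (fun s _ => (h.hasDerivWithinAt_quadratic hQ x s).continuousWithinAt)
    (fun s _ => (h.hasDerivWithinAt_quadratic hQ x s).mono interior_subset) fun s _ => ?_
  refine add_nonneg (hQ0 _) ?_
  by_cases hx : U s *ᵥ x = 0
  · simp [hx]
  · exact (hP0 _ hx).le

theorem quadratic_nonneg (hQ : Qᵀ = Q) (hQ0 : ∀ x, 0 ≤ x ⬝ᵥ Q *ᵥ x)
    (hP0 : ∀ x ≠ 0, 0 < x ⬝ᵥ P *ᵥ x) (x : n → ℝ) {s : ℝ} (hs : 0 ≤ s) :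
    0 ≤ x ⬝ᵥ ((U s)ᵀ * V s) *ᵥ x := by
  have h1 := h.monotoneOn_quadratic hQ hQ0 hP0 x Set.self_mem_Ici hs hs
  simpa [h.right_zero] using h1

/-- If `U s x = 0`, the nondecreasing function `x ⬝ᵥ Uᵀ V x` vanishes at both ends of `[0, s]`,
hence throughout. Its derivative at `0` is `x ⬝ᵥ P x`, which is positive unless `x = 0`. -/
theorem isUnit_left (hQ : Qᵀ = Q) (hQ0 : ∀ x, 0 ≤ x ⬝ᵥ Q *ᵥ x)
    (hP0 : ∀ x ≠ 0, 0 < x ⬝ᵥ P *ᵥ x) {s : ℝ} (hs : 0 ≤ s) : IsUnit (U s) := by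
  rw [← Matrix.mulVec_injective_iff_isUnit]
  refine (injective_iff_map_eq_zero (Matrix.mulVecLin (U s))).2 fun x hx => ?_
  rw [mulVecLin_apply] at hx
  rcases hs.eq_or_lt with rfl | hs'
  · simpa [h.left_zero] using hx
  by_contra hx0
  have hzero : ∀ t ∈ Set.Icc 0 s, x ⬝ᵥ ((U t)ᵀ * V t) *ᵥ x = 0 := fun t ht => by
    refine le_antisymm ?_ (h.quadratic_nonneg hQ hQ0 hP0 x ht.1)
    have h1 := h.monotoneOn_quadratic hQ hQ0 hP0 x ht.1 hs ht.2
    have h2 : x ⬝ᵥ ((U s)ᵀ * V s) *ᵥ x = 0 := by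
      rw [← mulVec_mulVec, dotProduct_mulVec, vecMul_transpose, hx, zero_dotProduct]
    exact h1.trans h2.le
  have h3 : HasDerivWithinAt (fun s => x ⬝ᵥ ((U s)ᵀ * V s) *ᵥ x) 0 (Set.Icc 0 s) 0 :=
    (hasDerivWithinAt_const 0 _ (0 : ℝ)).congr hzero (hzero 0 ⟨le_rfl, hs⟩)
  have h4 := UniqueDiffWithinAt.eq_deriv _ (uniqueDiffOn_Icc hs' 0 ⟨le_rfl, hs⟩) h3
    ((h.hasDerivWithinAt_quadratic hQ x 0).mono Set.Icc_subset_Ici_self)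
  have h5 := hP0 x hx0
  simp [h.right_zero, h.left_zero] at h4
  linarith

/-- Every solution of the Riccati equation is given by the Hamiltonian flow. -/
theorem right_eq {Y : ℝ → Matrix n n ℝ} (hY0 : Y 0 = 0)
    (hY : ∀ s, 0 ≤ s → HasMatDerivWithinAt Y (riccatiField P Q A (Y s)) (Set.Ici 0) s)
    {s : ℝ} (hs : 0 ≤ s) : V s = Y s * U s := by
  have hcY : ContinuousOn Y (Set.Ici 0) := continuousOn_of_hasMatDerivWithinAt hY
  have hR : ContinuousOn (fun s => Y s * Q + Aᵀ) (Set.Ici 0) := by fun_prop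
  -- The defect `V - Y U` solves a homogeneous linear equation with zero initial value, so each of
  -- its columns vanishes.
  have hE : ∀ s, 0 ≤ s → HasMatDerivWithinAt (fun s => V s - Y s * U s)
      (-((Y s * Q + Aᵀ) * (V s - Y s * U s))) (Set.Ici 0) s := fun s hs =>
    ((h.deriv_right s).sub ((hY s hs).mul (h.deriv_left s))).congr_deriv (by
      rw [riccatiField]; noncomm_ring)
  ext i j
  have h1 := eq_zero_of_linear_ode hR (e := fun s i => (V s - Y s * U s) i j)
    (by ext i; simp [h.right_zero, hY0]) (fun s hs i => by
      refine (hE s hs i j).congr_deriv ?_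
      simp [mul_apply, mulVec, dotProduct]) hs
  have h2 := congrFun h1 i
  simpa [sub_eq_zero] using h2

end IsHamiltonianFlow

end Riccati

/-! ### Existence, symmetry and monotonicity of Riccati solutions. -/

/-- `P` and `Q` are symmetric, `P` is positive definite and `Q` positive semidefinite. -/
structure IsRiccatiCost {n : Type*} [Fintype n] (P Q : Matrix n n ℝ) : Prop where
  symm_left : Pᵀ = P
  symm_right : Qᵀ = Q
  pos : ∀ x ≠ 0, 0 < x ⬝ᵥ P *ᵥ x
  nonneg : ∀ x, 0 ≤ x ⬝ᵥ Q *ᵥ x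

/-- `Y` solves the Riccati equation on `[0, ∞)` with initial value `0`. -/
structure IsRiccatiSolution {n : Type*} [Fintype n] (P Q A : Matrix n n ℝ)
    (Y : ℝ → Matrix n n ℝ) : Prop where
  zero : Y 0 = 0
  deriv : ∀ s, 0 ≤ s → HasMatDerivWithinAt Y (riccatiField P Q A (Y s)) (Set.Ici 0) s

theorem dotProduct_transpose_mul_mul_mulVec {m n : Type*} [Fintype m] [Fintype n]
    (U : Matrix m n ℝ) (M : Matrix m m ℝ) (x : n → ℝ) :
    x ⬝ᵥ (Uᵀ * M * U) *ᵥ x = (U *ᵥ x) ⬝ᵥ M *ᵥ (U *ᵥ x) := by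
  rw [← mulVec_mulVec, ← mulVec_mulVec, dotProduct_mulVec, vecMul_transpose]

section Riccati

variable {n : Type*} [Fintype n] [DecidableEq n] {P Q A : Matrix n n ℝ}

theorem exists_isRiccatiSolution (hPQ : IsRiccatiCost P Q) (A : Matrix n n ℝ) :
    ∃ Y, IsRiccatiSolution P Q A Y := by
  obtain ⟨U, V, h⟩ := exists_isHamiltonianFlow P Q A
  refine ⟨fun s => V s * (U s)⁻¹, ?_, fun s hs => ?_⟩
  · simp [h.right_zero]
  · have hU := h.isUnit_left hPQ.symm_right hPQ.nonneg hPQ.pos hs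
    have hdet := (Matrix.isUnit_iff_isUnit_det _).1 hU
    refine ((h.deriv_right s).mul ((h.deriv_left s).inv hU)).congr_deriv ?_
    have h1 : U s * (U s)⁻¹ = 1 := mul_nonsing_inv _ hdet
    have e1 : (P * U s - Aᵀ * V s) * (U s)⁻¹ = P - Aᵀ * (V s * (U s)⁻¹) := by
      rw [sub_mul, Matrix.mul_assoc, h1, Matrix.mul_one, Matrix.mul_assoc]
    have e2 : (A * U s + Q * V s) * (U s)⁻¹ = A + Q * (V s * (U s)⁻¹) := by
      rw [add_mul, Matrix.mul_assoc, h1, Matrix.mul_one, Matrix.mul_assoc]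
    rw [riccatiField, e1, Matrix.mul_assoc (U s)⁻¹, e2]
    noncomm_ring

namespace IsRiccatiSolution

variable {Y : ℝ → Matrix n n ℝ} (hY : IsRiccatiSolution P Q A Y) (hPQ : IsRiccatiCost P Q)
include hY hPQ

theorem exists_flow : ∃ U V, IsHamiltonianFlow P Q A U V ∧
    ∀ s, 0 ≤ s → IsUnit (U s) ∧ V s = Y s * U s := by
  obtain ⟨U, V, h⟩ := exists_isHamiltonianFlow P Q A
  exact ⟨U, V, h, fun s hs => ⟨h.isUnit_left hPQ.symm_right hPQ.nonneg hPQ.pos hs,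
    h.right_eq hY.zero hY.deriv hs⟩⟩

theorem symm {s : ℝ} (hs : 0 ≤ s) : (Y s)ᵀ = Y s := by
  obtain ⟨U, V, h, hUV⟩ := hY.exists_flow hPQ
  obtain ⟨hU, hV⟩ := hUV s hs
  have h1 := h.transpose_mul_eq hPQ.symm_left hPQ.symm_right hs
  rw [hV, transpose_mul, ← Matrix.mul_assoc] at h1
  have hUt : IsUnit (U s)ᵀ := (Matrix.isUnit_transpose _).2 hU
  exact (hUt.mul_left_cancel (hU.mul_right_cancel h1)).symm

theorem nonneg {s : ℝ} (hs : 0 ≤ s) (x : n → ℝ) : 0 ≤ x ⬝ᵥ Y s *ᵥ x := by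
  obtain ⟨U, V, h, hUV⟩ := hY.exists_flow hPQ
  obtain ⟨hU, hV⟩ := hUV s hs
  obtain ⟨z, rfl⟩ := (Matrix.mulVec_surjective_iff_isUnit.2 hU) x
  have h1 := h.quadratic_nonneg hPQ.symm_right hPQ.nonneg hPQ.pos z hs
  rwa [hV, ← Matrix.mul_assoc, dotProduct_transpose_mul_mul_mulVec] at h1

/-- Along the solution, `Z = Y'` satisfies `Z' = -Z (A + Q Y) - (A + Q Y)ᵀ Z`, while `U' = (A + Q Y)
U`. Hence `Uᵀ Z U` keeps its initial value `P`, and `Z` is congruent to `P`. -/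
theorem field_nonneg {s : ℝ} (hs : 0 ≤ s) (x : n → ℝ) :
    0 ≤ x ⬝ᵥ riccatiField P Q A (Y s) *ᵥ x := by
  obtain ⟨U, V, h, hUV⟩ := hY.exists_flow hPQ
  have hconst := eq_of_hasMatDerivWithinAt_zero
    (F := fun s => (U s)ᵀ * riccatiField P Q A (Y s) * U s) (fun t ht => by
      have hZ := ((((HasMatDerivWithinAt.const P).sub ((hY.deriv t ht).mul_const A)).sub
        ((hY.deriv t ht).const_mul Aᵀ)).sub (((hY.deriv t ht).mul_const Q).mul (hY.deriv t ht)))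
      refine (((h.deriv_left t).transpose.mul hZ).mul (h.deriv_left t)).congr_deriv ?_
      change _ + ((U t)ᵀ * riccatiField P Q A (Y t)) * _ = _
      change (_ * riccatiField P Q A (Y t) + _) * _ + _ = _
      rw [(hUV t ht).2]
      simp only [transpose_add, transpose_mul, hPQ.symm_right, hY.symm hPQ ht]
      noncomm_ring) hs
  obtain ⟨z, rfl⟩ := (Matrix.mulVec_surjective_iff_isUnit.2 (hUV s hs).1) x
  rw [← dotProduct_transpose_mul_mul_mulVec]
  have h1 : (U s)ᵀ * riccatiField P Q A (Y s) * U s = P := by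
    refine hconst.trans ?_
    simp [h.left_zero, hY.zero, riccatiField]
  rw [h1]
  by_cases hz : z = 0
  · simp [hz]
  · exact (hPQ.pos z hz).le

/-- Solvability of the linear equation driven by a solution of the Riccati equation. -/
theorem exists_linear_solution (v w : n → ℝ) : ∃ B : ℝ → n → ℝ, B 0 = 0 ∧
    ∀ s, 0 ≤ s → ∀ i, HasDerivWithinAt (fun s => B s i)
      (-((Y s * Q + Aᵀ) *ᵥ B s + (Y s *ᵥ v + w)) i) (Set.Ici 0) s := by
  obtain ⟨U, V, h, hUV⟩ := hY.exists_flow hPQ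
  have hcU := h.continuous_left
  have hcV := h.continuous_right
  -- Variation of constants: `(Uᵀ)' = Uᵀ (Y Q + Aᵀ)`, so `(Uᵀ B)' = -Uᵀ (Y v + w)`. Written through
  -- `V` and `U`, the integrand is continuous on all of `ℝ`.
  let I : ℝ → n → ℝ := fun s i => ∫ t in (0 : ℝ)..s, ((V t)ᵀ *ᵥ v + (U t)ᵀ *ᵥ w) i
  have hI : ∀ s i, HasDerivWithinAt (fun s => I s i) (((V s)ᵀ *ᵥ v + (U s)ᵀ *ᵥ w) i)
      (Set.Ici 0) s := fun s i => by
    have hc : Continuous fun t => ((V t)ᵀ *ᵥ v + (U t)ᵀ *ᵥ w) i := by fun_prop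
    exact (hc.integral_hasStrictDerivAt 0 s).hasDerivAt.hasDerivWithinAt
  refine ⟨fun s => -(((U s)ᵀ)⁻¹ *ᵥ I s), ?_, fun s hs i => ?_⟩
  · have : I 0 = 0 := by ext i; simp [I]
    simp [this]
  · obtain ⟨hU, hV⟩ := hUV s hs
    have hUt : IsUnit (U s)ᵀ := (Matrix.isUnit_transpose _).2 hU
    have h1 : ((U s)ᵀ)⁻¹ * (U s)ᵀ = 1 :=
      nonsing_inv_mul _ ((Matrix.isUnit_iff_isUnit_det _).1 hUt)
    have e1 : (A * U s + Q * V s)ᵀ = (U s)ᵀ * (Y s * Q + Aᵀ) := by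
      rw [hV]
      simp only [transpose_add, transpose_mul, hPQ.symm_right, hY.symm hPQ hs]
      noncomm_ring
    have e2 : (V s)ᵀ *ᵥ v + (U s)ᵀ *ᵥ w = (U s)ᵀ *ᵥ (Y s *ᵥ v + w) := by
      rw [hV, transpose_mul, hY.symm hPQ hs, mulVec_add, mulVec_mulVec]
    refine (((h.deriv_left s).transpose.inv hUt).mulVec (hI s) i).neg.congr_deriv ?_
    rw [e1, e2, ← Matrix.mul_assoc, h1, Matrix.one_mul, mulVec_mulVec, h1, one_mulVec,
      mulVec_neg, mulVec_mulVec, neg_mulVec]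

end IsRiccatiSolution

end Riccati

/-! ### Convergence of the Riccati solution. -/

/-- By the mean value theorem on `[k, k + 1]`, `f'` takes the values `f (k + 1) - f k → 0` along a
sequence going to infinity. It shows that the limit of `Y` is stationary. -/
theorem eq_zero_of_tendsto_of_tendsto_deriv {f f' : ℝ → ℝ} {a b : ℝ}
    (hf : ∀ s, 0 ≤ s → HasDerivWithinAt f (f' s) (Set.Ici 0) s) (ha : Tendsto f atTop (𝓝 a))
    (hb : Tendsto f' atTop (𝓝 b)) : b = 0 := by
  have h1 : ∀ k : ℕ, ∃ c ∈ Set.Ioo (k : ℝ) (k + 1), f' c = f (k + 1) - f k := fun k => by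
    have hk : (0 : ℝ) ≤ k := k.cast_nonneg
    obtain ⟨c, hc, h⟩ := exists_hasDerivAt_eq_slope f f' (lt_add_one (k : ℝ))
      (fun s hs => ((hf s (hk.trans hs.1)).continuousWithinAt).mono
        fun t ht => hk.trans ht.1)
      (fun s hs => (hf s (hk.trans hs.1.le)).hasDerivAt (Ici_mem_nhds (hk.trans_lt hs.1)))
    exact ⟨c, hc, by simpa using h⟩
  choose c hc hfc using h1
  have hcast : Tendsto (fun k : ℕ => (k : ℝ)) atTop atTop := tendsto_natCast_atTop_atTop
  have hct : Tendsto c atTop atTop := tendsto_atTop_mono (fun k => (hc k).1.le) hcast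
  have h2 : Tendsto (fun k : ℕ => f (k + 1) - f k) atTop (𝓝 (a - a)) :=
    (ha.comp (tendsto_atTop_add_const_right _ 1 hcast)).sub (ha.comp hcast)
  have h3 := tendsto_nhds_unique (hb.comp hct) (h2.congr fun k => (hfc k).symm)
  simpa using h3

theorem exists_tendsto_of_monotoneOn_of_le {f : ℝ → ℝ} {K : ℝ} (hf : MonotoneOn f (Set.Ici 0))
    (hK : ∀ s, 0 ≤ s → f s ≤ K) : ∃ a, Tendsto f atTop (𝓝 a) := by
  have hmono : Monotone fun s => f (max s 0) := fun s t hst =>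
    hf (le_max_right s 0) (le_max_right t 0) (max_le_max_right 0 hst)
  have hbdd : BddAbove (Set.range fun s => f (max s 0)) :=
    ⟨K, by rintro _ ⟨s, rfl⟩; exact hK _ (le_max_right _ _)⟩
  refine ⟨_, (tendsto_atTop_ciSup hmono hbdd).congr' ?_⟩
  filter_upwards [eventually_ge_atTop 0] with s hs
  rw [max_eq_left hs]

theorem single_add_dotProduct_mulVec_single_add {n : Type*} [Fintype n] [DecidableEq n]
    {Y : Matrix n n ℝ} (hY : Yᵀ = Y) (i j : n) (c : ℝ) :
    (Pi.single i 1 + c • Pi.single j 1 : n → ℝ) ⬝ᵥ Y *ᵥ (Pi.single i 1 + c • Pi.single j 1) =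
      Y i i + 2 * c * Y i j + c ^ 2 * Y j j := by
  have h : Y j i = Y i j := congrFun (congrFun hY i) j
  simp only [mulVec_add, mulVec_smul, add_dotProduct, dotProduct_add, smul_dotProduct,
    dotProduct_smul, single_one_dotProduct, mulVec_single_one, smul_eq_mul, col_apply, h]
  ring

namespace IsRiccatiSolution

variable {n : Type*} [Fintype n] [DecidableEq n] {P Q A : Matrix n n ℝ} {Y : ℝ → Matrix n n ℝ}
  (hY : IsRiccatiSolution P Q A Y) (hPQ : IsRiccatiCost P Q)
include hY hPQ

theorem monotoneOn_quadratic (x : n → ℝ) :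
    MonotoneOn (fun s => x ⬝ᵥ Y s *ᵥ x) (Set.Ici 0) := by
  have h1 : ∀ s, 0 ≤ s → HasDerivWithinAt (fun s => x ⬝ᵥ Y s *ᵥ x)
      (x ⬝ᵥ riccatiField P Q A (Y s) *ᵥ x) (Set.Ici 0) s := fun s hs => by
    simpa using hasDerivWithinAt_dotProduct (x := fun _ => x) (x' := 0)
      (fun i => hasDerivWithinAt_const s (Set.Ici (0 : ℝ)) (x i))
      ((hY.deriv s hs).mulVec_const x)
  refine monotoneOn_of_hasDerivWithinAt_nonneg (convex_Ici 0)
    (fun s hs => (h1 s hs).continuousWithinAt)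
    (fun s hs => (h1 s (interior_subset hs)).mono interior_subset)
    fun s hs => hY.field_nonneg hPQ (interior_subset hs) x

/-- Substituting `A = δ - Q N` and completing the square turns `Y' ≥ 0` into `Y δ + δ Y ≤ P + Nᵀ Q
N`. As `δ` is diagonal, the diagonal entries of the left side are `2 δ i * Y i i`. -/
theorem diag_le {N : Matrix n n ℝ} {δ : n → ℝ} (hδ : ∀ i, 0 < δ i)
    (hN : A + Q * N = diagonal δ) (i : n) {s : ℝ} (hs : 0 ≤ s) :
    Y s i i ≤ (P + Nᵀ * Q * N) i i / (2 * δ i) := by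
  have hsym := hY.symm hPQ hs
  have hA : A = diagonal δ - Q * N := eq_sub_of_add_eq hN
  have e : riccatiField P Q A (Y s) = (P + Nᵀ * Q * N) - Y s * diagonal δ - diagonal δ * Y s
      - (Y s - N)ᵀ * Q * (Y s - N) := by
    rw [riccatiField, hA]
    simp only [transpose_sub, transpose_mul, diagonal_transpose, hPQ.symm_right, hsym]
    noncomm_ring
  have h1 := hY.field_nonneg hPQ hs (Pi.single i 1)
  have h2 := hPQ.nonneg ((Y s - N) *ᵥ Pi.single i 1)
  rw [← dotProduct_transpose_mul_mul_mulVec] at h2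
  rw [e] at h1
  rw [single_one_dotProduct, mulVec_single_one, col_apply] at h1 h2
  simp only [Matrix.sub_apply, mul_diagonal, diagonal_mul] at h1 h2
  rw [le_div_iff₀ (by linarith [hδ i])]
  linarith

/-- If `(A, Q)` is stabilized to a positive diagonal matrix, the solution of the Riccati equation
converges to a positive definite stationary point. -/
theorem exists_limit {N : Matrix n n ℝ} {δ : n → ℝ} (hδ : ∀ i, 0 < δ i)
    (hN : A + Q * N = diagonal δ) :
    ∃ L, Tendsto Y atTop (𝓝 L) ∧ Lᵀ = L ∧ (∀ x ≠ 0, 0 < x ⬝ᵥ L *ᵥ x) ∧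
      riccatiField P Q A L = 0 := by
  let D : n → ℝ := fun i => (P + Nᵀ * Q * N) i i / (2 * δ i)
  have hquad : ∀ i j (c : ℝ), ∃ a, Tendsto (fun s =>
      (Pi.single i 1 + c • Pi.single j 1 : n → ℝ) ⬝ᵥ Y s *ᵥ (Pi.single i 1 + c • Pi.single j 1))
      atTop (𝓝 a) := fun i j c => by
    -- The bound `K` comes from the parallelogram identity: the forms at `e_i + c e_j` and `e_i - c
    -- e_j` add up to `2 Y i i + 2 c ^ 2 * Y j j`, and the second is nonnegative.
    refine exists_tendsto_of_monotoneOn_of_le (hY.monotoneOn_quadratic hPQ _)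
      (K := 2 * D i + 2 * c ^ 2 * D j) fun s hs => ?_
    have h1 := hY.nonneg hPQ hs (Pi.single i 1 + (-c) • Pi.single j 1)
    rw [single_add_dotProduct_mulVec_single_add (hY.symm hPQ hs)] at h1 ⊢
    have h2 : Y s i i ≤ D i := hY.diag_le hPQ hδ hN i hs
    have h3 : Y s j j ≤ D j := hY.diag_le hPQ hδ hN j hs
    nlinarith [mul_le_mul_of_nonneg_left h3 (sq_nonneg c)]
  have hentry : ∀ i j, ∃ a, Tendsto (fun s => Y s i j) atTop (𝓝 a) := fun i j => by
    obtain ⟨a, ha⟩ := hquad i j 1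
    obtain ⟨b, hb⟩ := hquad i i 0
    obtain ⟨c, hc⟩ := hquad j j 0
    -- Polarization; the choice `c = 0` in `hquad` yields the diagonal entries.
    refine ⟨(a - b - c) / 2, (((ha.sub hb).sub hc).div_const 2).congr' ?_⟩
    filter_upwards [eventually_ge_atTop 0] with s hs
    simp only [single_add_dotProduct_mulVec_single_add (hY.symm hPQ hs)]
    ring
  choose L hL using hentry
  have hlim : Tendsto Y atTop (𝓝 (Matrix.of L)) :=
    tendsto_pi_nhds.2 fun i => tendsto_pi_nhds.2 fun j => hL i j
  generalize Matrix.of L = L at hlim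
  have hsym : Lᵀ = L := by
    have h1 : Tendsto (fun s => (Y s)ᵀ) atTop (𝓝 Lᵀ) :=
      (continuous_id.matrix_transpose.tendsto L).comp hlim
    refine tendsto_nhds_unique (h1.congr' ?_) hlim
    filter_upwards [eventually_ge_atTop 0] with s hs
    exact hY.symm hPQ hs
  have hfield : riccatiField P Q A L = 0 := by
    have hc : Continuous fun Z => riccatiField P Q A Z := by unfold riccatiField; fun_prop
    have h1 : Tendsto (fun s => riccatiField P Q A (Y s)) atTop (𝓝 (riccatiField P Q A L)) :=
      (hc.tendsto L).comp hlim
    ext i j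
    exact eq_zero_of_tendsto_of_tendsto_deriv (fun s hs => hY.deriv s hs i j)
      (tendsto_pi_nhds.1 (tendsto_pi_nhds.1 hlim i) j)
      (tendsto_pi_nhds.1 (tendsto_pi_nhds.1 h1 i) j)
  have hnonneg : ∀ x, 0 ≤ x ⬝ᵥ L *ᵥ x := fun x => by
    have hc : Continuous fun Z : Matrix n n ℝ => x ⬝ᵥ Z *ᵥ x := by fun_prop
    refine ge_of_tendsto ((hc.tendsto L).comp hlim) ?_
    filter_upwards [eventually_ge_atTop 0] with s hs
    exact hY.nonneg hPQ hs x
  refine ⟨L, hlim, hsym, fun x hx => (hnonneg x).lt_of_ne' fun h0 => ?_, hfield⟩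
  have hpsd : L.PosSemidef := PosSemidef.of_dotProduct_mulVec_nonneg
    (by rw [IsHermitian, conjTranspose_eq_transpose_of_trivial, hsym]) (by simpa using hnonneg)
  have h1 : L *ᵥ x = 0 := by
    have := hpsd.dotProduct_mulVec_zero_iff x
    exact this.1 (by simpa using h0)
  have h2 : x ᵥ* L = 0 := by rw [← mulVec_transpose, hsym, h1]
  -- On the kernel of `L` every term of the stationary equation except `P` drops out.
  have h3 : x ⬝ᵥ riccatiField P Q A L *ᵥ x = x ⬝ᵥ P *ᵥ x := by
    simp only [riccatiField, sub_mulVec, dotProduct_sub, ← mulVec_mulVec, h1, mulVec_zero, sub_zero]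
    rw [dotProduct_mulVec x L, h2, zero_dotProduct, sub_zero]
  rw [hfield] at h3
  have h4 := hPQ.pos x hx
  simp at h3
  linarith

end IsRiccatiSolution

/-! ### Lyapunov matrices: eigenvalues and linear equations. -/

section Lyapunov

variable {n : Type*} [Fintype n] [DecidableEq n]

theorem isUnit_of_dotProduct_mulVec_pos {L : Matrix n n ℝ} (hL : ∀ x ≠ 0, 0 < x ⬝ᵥ L *ᵥ x) :
    IsUnit L := by
  rw [← Matrix.mulVec_injective_iff_isUnit]
  refine (injective_iff_map_eq_zero (Matrix.mulVecLin L)).2 fun x hx => ?_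
  rw [mulVecLin_apply] at hx
  by_contra hx0
  have := hL x hx0
  simp [hx] at this

theorem dotProduct_inv_mulVec_pos {L : Matrix n n ℝ}
    (hL : ∀ x ≠ 0, 0 < x ⬝ᵥ L *ᵥ x) (x : n → ℝ) (hx : x ≠ 0) : 0 < x ⬝ᵥ L⁻¹ *ᵥ x := by
  have hU := isUnit_of_dotProduct_mulVec_pos hL
  obtain ⟨z, rfl⟩ := (Matrix.mulVec_surjective_iff_isUnit.2 hU) x
  have hz : z ≠ 0 := by
    rintro rfl
    exact hx (mulVec_zero L)
  have h1 := nonsing_inv_mul _ ((Matrix.isUnit_iff_isUnit_det _).1 hU)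
  rw [mulVec_mulVec, h1, one_mulVec, dotProduct_comm]
  exact hL z hz

/-- At a positive definite stationary point `L` of the Riccati equation, `L⁻¹` is a Lyapunov matrix
for `L Q + Aᵀ`. -/
theorem dotProduct_inv_mul_mulVec_pos {P Q A L : Matrix n n ℝ} (hPQ : IsRiccatiCost P Q)
    (hsym : Lᵀ = L) (hL : ∀ x ≠ 0, 0 < x ⬝ᵥ L *ᵥ x) (h : riccatiField P Q A L = 0)
    (x : n → ℝ) (hx : x ≠ 0) : 0 < x ⬝ᵥ (L⁻¹ * (L * Q + Aᵀ)) *ᵥ x := by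
  have hU := isUnit_of_dotProduct_mulVec_pos hL
  obtain ⟨z, rfl⟩ := (Matrix.mulVec_surjective_iff_isUnit.2 hU) x
  have hz : z ≠ 0 := by
    rintro rfl
    exact hx (mulVec_zero L)
  have h1 := mul_nonsing_inv _ ((Matrix.isUnit_iff_isUnit_det _).1 hU)
  rw [← dotProduct_transpose_mul_mul_mulVec, hsym, ← Matrix.mul_assoc, h1, Matrix.one_mul]
  have e : (L * Q + Aᵀ) * L + ((L * Q + Aᵀ) * L)ᵀ = P + Lᵀ * Q * L := by
    rw [← sub_eq_zero, ← neg_eq_zero, ← h, riccatiField]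
    simp only [transpose_add, transpose_mul, hsym, hPQ.symm_right, transpose_transpose]
    noncomm_ring
  have h2 : z ⬝ᵥ ((L * Q + Aᵀ) * L)ᵀ *ᵥ z = z ⬝ᵥ ((L * Q + Aᵀ) * L) *ᵥ z := by
    rw [mulVec_transpose, dotProduct_comm, ← dotProduct_mulVec]
  have h3 := congrArg (fun X => z ⬝ᵥ X *ᵥ z) e
  simp only [add_mulVec (_ : Matrix n n ℝ) _ z, dotProduct_add, h2,
    dotProduct_transpose_mul_mul_mulVec] at h3 ⊢
  have h4 := hPQ.pos z hz
  have h5 := hPQ.nonneg (L *ᵥ z)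
  linarith

/-- Lyapunov's criterion: complex eigenvalues of `R` have positive real part. -/
theorem re_pos_of_hasEigenvalue {G R : Matrix n n ℝ} (hsym : Gᵀ = G)
    (hG : ∀ x ≠ 0, 0 < x ⬝ᵥ G *ᵥ x) (hR : ∀ x ≠ 0, 0 < x ⬝ᵥ (G * R) *ᵥ x) {z : ℂ}
    (hz : Module.End.HasEigenvalue (Matrix.toLin' (R.map Complex.ofReal)) z) : 0 < z.re := by
  obtain ⟨v, hv⟩ := hz.exists_hasEigenvector
  have hv0 : v ≠ 0 := hv.2
  have he : R.map Complex.ofReal *ᵥ v = z • v := by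
    simpa [Matrix.toLin'_apply] using hv.apply_eq_smul
  let x : n → ℝ := fun i => (v i).re
  let y : n → ℝ := fun i => (v i).im
  have hx : R *ᵥ x = z.re • x - z.im • y := by
    ext i
    have h1 := congrArg Complex.re (congrFun he i)
    simpa [mulVec, dotProduct, x, y] using h1
  have hy : R *ᵥ y = z.re • y + z.im • x := by
    ext i
    have h1 := congrArg Complex.im (congrFun he i)
    simpa [mulVec, dotProduct, x, y] using h1
  have hcomm : x ⬝ᵥ G *ᵥ y = y ⬝ᵥ G *ᵥ x := by
    rw [dotProduct_mulVec, ← mulVec_transpose, hsym, dotProduct_comm]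
  -- With `v = x + i y`, adding the two real forms cancels the `z.im` terms because `G` is
  -- symmetric.
  have hsum : x ⬝ᵥ (G * R) *ᵥ x + y ⬝ᵥ (G * R) *ᵥ y =
      z.re * (x ⬝ᵥ G *ᵥ x + y ⬝ᵥ G *ᵥ y) := by
    rw [← mulVec_mulVec, ← mulVec_mulVec, hx, hy, mulVec_sub, mulVec_add]
    simp only [mulVec_smul, dotProduct_sub, dotProduct_add, dotProduct_smul, smul_eq_mul, hcomm]
    ring
  have hnonneg : ∀ {H : Matrix n n ℝ}, (∀ x ≠ 0, 0 < x ⬝ᵥ H *ᵥ x) → ∀ x, 0 ≤ x ⬝ᵥ H *ᵥ x :=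
    fun hH x => by
      by_cases h0 : x = 0
      · simp [h0]
      · exact (hH x h0).le
  have hpos : ∀ {H : Matrix n n ℝ}, (∀ x ≠ 0, 0 < x ⬝ᵥ H *ᵥ x) →
      0 < x ⬝ᵥ H *ᵥ x + y ⬝ᵥ H *ᵥ y := fun hH => by
    by_cases hx0 : x = 0
    · have hy0 : y ≠ 0 := fun hy0 => hv0 (funext fun i =>
        Complex.ext (congrFun hx0 i) (congrFun hy0 i))
      exact add_pos_of_nonneg_of_pos (hnonneg hH x) (hH y hy0)
    · exact add_pos_of_pos_of_nonneg (hH x hx0) (hnonneg hH y)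
  have h1 := hpos hR
  rw [hsum] at h1
  exact pos_of_mul_pos_left h1 (hpos hG).le

/-- Solutions of `B' = -(R B + f)` converge when `R` and `f` converge and the limit of `R` admits a
Lyapunov matrix. -/
theorem exists_tendsto_of_linear_ode {R : ℝ → Matrix n n ℝ} {R₀ G : Matrix n n ℝ}
    {f B : ℝ → n → ℝ} {f₀ : n → ℝ} (hsym : Gᵀ = G) (hG : ∀ x ≠ 0, 0 < x ⬝ᵥ G *ᵥ x)
    (hR₀ : ∀ x ≠ 0, 0 < x ⬝ᵥ (G * R₀) *ᵥ x) (hR : Tendsto R atTop (𝓝 R₀))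
    (hf : Tendsto f atTop (𝓝 f₀))
    (hB : ∀ s, 0 ≤ s → ∀ i, HasDerivWithinAt (fun s => B s i) (-(R s *ᵥ B s + f s) i)
      (Set.Ici 0) s) : ∃ b, Tendsto B atTop (𝓝 b) := by
  have hU : IsUnit R₀ := by
    have h1 := (Matrix.isUnit_iff_isUnit_det _).1 (isUnit_of_dotProduct_mulVec_pos hR₀)
    rw [det_mul] at h1
    exact (Matrix.isUnit_iff_isUnit_det _).2 (isUnit_of_mul_isUnit_right h1)
  -- The candidate limit is the equilibrium `R₀ b = -f₀`; the deviation `e = B - b` is measured by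
  -- `e ⬝ᵥ G e`.
  obtain ⟨b, hb⟩ := (Matrix.mulVec_surjective_iff_isUnit.2 hU) (-f₀)
  let e : ℝ → n → ℝ := fun s => B s - b
  let k : ℝ → n → ℝ := fun s => G *ᵥ (R s *ᵥ b + f s)
  have hk : Tendsto k atTop (𝓝 0) := by
    have hc : Continuous fun p : Matrix n n ℝ × (n → ℝ) => G *ᵥ (p.1 *ᵥ b + p.2) := by fun_prop
    have h1 := (hc.tendsto (R₀, f₀)).comp (hR.prodMk_nhds hf)
    simpa [hb, Function.comp_def] using h1
  have hkk : Tendsto (fun s => k s ⬝ᵥ k s) atTop (𝓝 0) := by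
    have hc : Continuous fun x : n → ℝ => x ⬝ᵥ x := by fun_prop
    simpa [Function.comp_def] using (hc.tendsto 0).comp hk
  have hxx : ∀ x : n → ℝ, 0 ≤ x ⬝ᵥ x := fun x => Finset.sum_nonneg fun i _ => mul_self_nonneg _
  have hV : ∀ s, 0 ≤ s → HasDerivWithinAt (fun s => e s ⬝ᵥ G *ᵥ e s)
      (-2 * (e s ⬝ᵥ (G * R s) *ᵥ e s) - 2 * (e s ⬝ᵥ k s)) (Set.Ici 0) s := fun s hs => by
    have he : ∀ i, HasDerivWithinAt (fun s => e s i) (-(R s *ᵥ B s + f s) i) (Set.Ici 0) s :=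
      fun i => (hB s hs i).sub_const _
    refine (hasDerivWithinAt_dotProduct he
      ((HasMatDerivWithinAt.const G).mulVec he)).congr_deriv ?_
    have e1 : R s *ᵥ B s + f s = R s *ᵥ e s + (R s *ᵥ b + f s) := by
      simp only [e, mulVec_sub]; abel
    have e2 : ∀ x, x ⬝ᵥ G *ᵥ e s = e s ⬝ᵥ G *ᵥ x := fun x => by
      rw [dotProduct_mulVec, ← mulVec_transpose, hsym, dotProduct_comm]
    rw [e2, zero_mulVec, zero_add]
    change e s ⬝ᵥ G *ᵥ (-(R s *ᵥ B s + f s)) + e s ⬝ᵥ G *ᵥ (-(R s *ᵥ B s + f s)) = _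
    rw [e1, mulVec_neg, mulVec_add, dotProduct_neg, dotProduct_add,
      ← mulVec_mulVec]
    ring
  obtain ⟨c, hc, hcR⟩ := exists_pos_eventually_le_dotProduct_mulVec hR₀
    (H := fun s => G * R s) (l := atTop)
    (((continuous_const.matrix_mul continuous_id).tendsto R₀).comp hR)
  obtain ⟨c', hc', hcG⟩ := exists_pos_eventually_le_dotProduct_mulVec hG
    (H := fun _ : ℝ => G) (l := atTop) tendsto_const_nhds
  obtain ⟨-, hcG⟩ := hcG.exists
  have hnonneg : ∀ x, 0 ≤ x ⬝ᵥ G *ᵥ x := fun x =>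
    (mul_nonneg hc'.le (hxx x)).trans (hcG x)
  -- The summand `1` keeps `K` positive when the index type is empty.
  let K : ℝ := (∑ i, ∑ j, |G i j|) + 1
  have hK : 0 < K := by positivity
  have hGK : ∀ x, x ⬝ᵥ G *ᵥ x ≤ K * (x ⬝ᵥ x) := fun x => by
    have h1 := (le_abs_self _).trans (abs_dotProduct_mulVec_le G x)
    simp only [K]
    linarith [hxx x]
  have hVlim : Tendsto (fun s => e s ⬝ᵥ G *ᵥ e s) atTop (𝓝 0) := by
    refine tendsto_zero_of_deriv_le (c := c / K) (k := fun s => c⁻¹ * (k s ⬝ᵥ k s))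
      (by positivity) (fun s => hnonneg _) hV ?_ (by simpa using hkk.const_mul c⁻¹)
    filter_upwards [hcR] with s hs
    have h1 := hs (e s)
    have h2 : c / K * (e s ⬝ᵥ G *ᵥ e s) ≤ c * (e s ⬝ᵥ e s) := by
      refine (mul_le_mul_of_nonneg_left (hGK (e s)) (by positivity)).trans_eq ?_
      field_simp
    -- Young's inequality: half of the decay `-2 c (e ⬝ᵥ e)` absorbs the cross term with `k`.
    have h3 : 0 ≤ c * (e s ⬝ᵥ e s) + 2 * (e s ⬝ᵥ k s) + c⁻¹ * (k s ⬝ᵥ k s) := by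
      have h4 := mul_nonneg hc.le (hxx (e s + c⁻¹ • k s))
      simp only [add_dotProduct, dotProduct_add, smul_dotProduct, dotProduct_smul, smul_eq_mul,
        dotProduct_comm (k s) (e s)] at h4
      refine h4.trans_eq ?_
      field_simp
      ring
    linarith
  refine ⟨b, ?_⟩
  have hee : Tendsto (fun s => e s ⬝ᵥ e s) atTop (𝓝 0) := by
    refine squeeze_zero (fun s => hxx _) (fun s => ?_) (by simpa using hVlim.const_mul c'⁻¹)
    rw [le_inv_mul_iff₀ hc']
    exact hcG (e s)
  refine tendsto_pi_nhds.2 fun i => tendsto_sub_nhds_zero_iff.1 ?_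
  have hi : Tendsto (fun s => (B s i - b i) ^ 2) atTop (𝓝 0) := by
    refine squeeze_zero (fun s => sq_nonneg _) (fun s => ?_) hee
    rw [sq]
    exact Finset.single_le_sum (f := fun i => e s i * e s i) (fun i _ => mul_self_nonneg _)
      (Finset.mem_univ i)
  have h1 := hi.sqrt
  simp only [Real.sqrt_sq_eq_abs, Real.sqrt_zero] at h1
  exact (tendsto_zero_iff_abs_tendsto_zero _).2 h1

end Lyapunov

/-! ### Time reversal and the market's Riccati coefficients. -/

theorem hasDerivWithinAt_reflect {f : ℝ → ℝ} {f' T : ℝ} {s : ℝ}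
    (hf : HasDerivWithinAt f f' (Set.Iic T) (T - s)) :
    HasDerivWithinAt (fun s => f (T - s)) (-f') (Set.Ici 0) s := by
  have h := hf.scomp s ((hasDerivWithinAt_id s (Set.Ici 0)).const_sub T)
    fun t ht => sub_le_self T (Set.mem_Ici.1 ht)
  simpa [Function.comp_def] using h

theorem hasDerivWithinAt_reflect_symm {f : ℝ → ℝ} {f' T : ℝ} {t : ℝ}
    (hf : HasDerivWithinAt f f' (Set.Ici 0) (T - t)) :
    HasDerivWithinAt (fun t => f (T - t)) (-f') (Set.Iic T) t := by
  have h := hf.scomp t ((hasDerivWithinAt_id t (Set.Iic T)).const_sub T)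
    fun t ht => sub_nonneg.2 (Set.mem_Iic.1 ht)
  simpa [Function.comp_def] using h

namespace CointegratedMarket

variable {d m : ℕ} (M : CointegratedMarket d m)

/-- Quadratic coefficient of the Riccati equation. -/
noncomputable def quadCoeff (γ : ℝ) : Matrix (Fin d) (Fin d) ℝ :=
  (2 * γ / (1 - γ)) • (M.Sigma2ᵀ * M.Sigma1⁻¹ * M.Sigma2) + (2 : ℝ) • M.Sigma3

/-- Linear coefficient of the Riccati equation. -/
noncomputable def linCoeff (γ : ℝ) : Matrix (Fin d) (Fin d) ℝ :=
  (γ / (1 - γ)) • (M.Sigma2ᵀ * M.Sigma1⁻¹ * M.delta) + M.delta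

/-- Constant coefficient of the Riccati equation. -/
noncomputable def constCoeff (γ : ℝ) : Matrix (Fin d) (Fin d) ℝ :=
  -((γ / (2 * (1 - γ))) • (M.delta * M.Sigma1⁻¹ * M.delta))

theorem Sigma1_pos (x : Fin d → ℝ) (hx : x ≠ 0) : 0 < x ⬝ᵥ M.Sigma1 *ᵥ x := by
  simpa [Sigma1] using M.posDef1.dotProduct_mulVec_pos hx

theorem Sigma0_nonneg (x : Fin m → ℝ) : 0 ≤ x ⬝ᵥ M.Sigma0 *ᵥ x := by
  simpa [Sigma0] using M.posDef0.posSemidef.dotProduct_mulVec_nonneg x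

theorem transpose_Sigma1 : M.Sigma1ᵀ = M.Sigma1 := by
  rw [Sigma1, transpose_mul, transpose_transpose]

theorem transpose_Sigma0 : M.Sigma0ᵀ = M.Sigma0 := by
  rw [Sigma0, transpose_mul, transpose_transpose]

theorem beta_mul_Sigma0 : M.beta * M.Sigma0 = M.Psi1 * M.Psi0ᵀ := by
  have h : IsUnit M.Sigma0.det := (Matrix.isUnit_iff_isUnit_det _).1 M.posDef0.isUnit
  rw [beta, Matrix.mul_assoc, nonsing_inv_mul _ h, Matrix.mul_one]

theorem Sigma1_sub_Sigma2 : M.Sigma1 - M.Sigma2 = M.beta * M.Sigma0 * M.betaᵀ := by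
  rw [Sigma2, sub_sub_cancel, beta_mul_Sigma0]

/-- By `Ψ₀ Ψ₁ᵀ = Σ₀ βᵀ`, the last two terms of `Sigma3` cancel. -/
theorem Sigma3_eq_Sigma2 : M.Sigma3 = M.Sigma2 := by
  have h : M.Psi0 * M.Psi1ᵀ = M.Sigma0 * M.betaᵀ := by
    have h1 := congrArg transpose M.beta_mul_Sigma0
    rw [transpose_mul, transpose_mul, transpose_transpose, transpose_Sigma0] at h1
    exact h1.symm
  rw [Sigma3, Sigma2, Matrix.mul_assoc M.beta M.Psi0, h, ← Matrix.mul_assoc, sub_add_cancel]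

theorem Sigma2_eq_mul_transpose :
    M.Sigma2 = (M.Psi1 - M.beta * M.Psi0) * (M.Psi1 - M.beta * M.Psi0)ᵀ := by
  rw [← Sigma3_eq_Sigma2, Sigma3, Sigma1, Sigma0]
  simp only [transpose_sub, transpose_mul, Matrix.mul_sub, Matrix.sub_mul, Matrix.mul_assoc]
  abel

theorem transpose_Sigma2 : M.Sigma2ᵀ = M.Sigma2 := by
  rw [Sigma2_eq_mul_transpose, transpose_mul, transpose_transpose]

theorem Sigma2_nonneg (x : Fin d → ℝ) : 0 ≤ x ⬝ᵥ M.Sigma2 *ᵥ x := by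
  rw [Sigma2_eq_mul_transpose, ← mulVec_mulVec, dotProduct_mulVec, ← mulVec_transpose]
  exact Finset.sum_nonneg fun i _ => mul_self_nonneg _

theorem Sigma2_le_Sigma1 (x : Fin d → ℝ) : x ⬝ᵥ M.Sigma2 *ᵥ x ≤ x ⬝ᵥ M.Sigma1 *ᵥ x := by
  have h1 := M.Sigma0_nonneg (M.betaᵀ *ᵥ x)
  rw [← dotProduct_transpose_mul_mul_mulVec, transpose_transpose, ← Sigma1_sub_Sigma2,
    sub_mulVec, dotProduct_sub] at h1
  linarith

theorem isUnit_det_Sigma1 : IsUnit M.Sigma1.det :=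
  (Matrix.isUnit_iff_isUnit_det _).1 (isUnit_of_dotProduct_mulVec_pos M.Sigma1_pos)

/-- Put `y = Σ₁⁻¹ Σ₂ x`, so the left side is `y ⬝ᵥ Σ₁ y`. Expand `0 ≤ (x - y) ⬝ᵥ Σ₂ (x - y)` and
bound `y ⬝ᵥ Σ₂ y` by `y ⬝ᵥ Σ₁ y`. -/
theorem dotProduct_Sigma2_mul_inv_mul_le (x : Fin d → ℝ) :
    x ⬝ᵥ (M.Sigma2 * M.Sigma1⁻¹ * M.Sigma2) *ᵥ x ≤ x ⬝ᵥ M.Sigma2 *ᵥ x := by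
  let y := M.Sigma1⁻¹ *ᵥ M.Sigma2 *ᵥ x
  have h1 : M.Sigma1 *ᵥ y = M.Sigma2 *ᵥ x := by
    simp only [y]
    rw [mulVec_mulVec, mul_nonsing_inv _ M.isUnit_det_Sigma1, one_mulVec]
  have hsymm : x ⬝ᵥ M.Sigma2 *ᵥ y = y ⬝ᵥ M.Sigma1 *ᵥ y := by
    rw [dotProduct_mulVec, ← mulVec_transpose, transpose_Sigma2, ← h1, dotProduct_comm]
  have e : x ⬝ᵥ (M.Sigma2 * M.Sigma1⁻¹ * M.Sigma2) *ᵥ x = y ⬝ᵥ M.Sigma1 *ᵥ y := by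
    rw [← hsymm, ← mulVec_mulVec, ← mulVec_mulVec]
  have h2 := M.Sigma2_nonneg (x - y)
  have h3 := M.Sigma2_le_Sigma1 y
  rw [mulVec_sub, dotProduct_sub, sub_dotProduct, sub_dotProduct, hsymm, ← h1] at h2
  rw [e, ← h1]
  linarith

variable {γ : ℝ}

theorem neg_one_lt_div_one_sub (hγ : γ < 0) : -1 < γ / (1 - γ) := by
  rw [lt_div_iff₀ (by linarith)]
  linarith

theorem transpose_inv_Sigma1 : (M.Sigma1⁻¹)ᵀ = M.Sigma1⁻¹ := by
  rw [transpose_nonsing_inv, transpose_Sigma1]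

theorem isRiccatiCost (hγ : γ < 0) : IsRiccatiCost (M.constCoeff γ) (M.quadCoeff γ) := by
  have hg := neg_one_lt_div_one_sub hγ
  have hg0 : γ / (1 - γ) < 0 := div_neg_of_neg_of_pos hγ (by linarith)
  refine ⟨?_, ?_, fun x hx => ?_, fun x => ?_⟩
  · simp only [constCoeff, delta, transpose_neg, transpose_smul, transpose_mul,
      transpose_inv_Sigma1, diagonal_transpose, Matrix.mul_assoc]
  · simp only [quadCoeff, transpose_add, transpose_smul, transpose_mul, transpose_inv_Sigma1,
      Sigma3_eq_Sigma2, transpose_Sigma2, Matrix.mul_assoc]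
  · have h1 : M.delta *ᵥ x ≠ 0 := fun h => hx <| funext fun i => by
      have h2 := congrFun h i
      rw [delta, mulVec_diagonal] at h2
      simpa [(M.speed_pos i).ne'] using h2
    have h2 := dotProduct_inv_mulVec_pos M.Sigma1_pos _ h1
    rw [← dotProduct_transpose_mul_mul_mulVec, delta, diagonal_transpose, ← delta] at h2
    have h3 : 0 < -(γ / (2 * (1 - γ))) :=
      neg_pos.2 (div_neg_of_neg_of_pos hγ (by linarith))
    rw [constCoeff, ← neg_smul, smul_mulVec, dotProduct_smul]
    exact mul_pos h3 h2
  · have h1 := M.dotProduct_Sigma2_mul_inv_mul_le x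
    have h2 := M.Sigma2_nonneg x
    rw [quadCoeff, transpose_Sigma2, Sigma3_eq_Sigma2, add_mulVec, dotProduct_add, smul_mulVec,
      smul_mulVec, dotProduct_smul, dotProduct_smul, smul_eq_mul, smul_eq_mul, mul_div_assoc]
    nlinarith

/-- The linear coefficient of the Riccati equation is stabilized to the mean reversion speeds. -/
theorem exists_linCoeff_add_quadCoeff_mul (hγ : γ < 0) :
    ∃ N, M.linCoeff γ + M.quadCoeff γ * N = diagonal M.speed := by
  set g := γ / (1 - γ) with hgdef
  have hg : -1 < g := neg_one_lt_div_one_sub hγ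
  have hg0 : g < 0 := div_neg_of_neg_of_pos hγ (by linarith)
  -- `Q = 2 Σ₂ Σ₁⁻¹ H`, and `H` is positive definite since `-1 < g < 0` and `Σ₂ ≤ Σ₁`. Thus `N =
  -- -(g/2) H⁻¹ δ` cancels the term `g Σ₂ Σ₁⁻¹ δ` of `A`, even when `Q` is singular.
  let H := M.Sigma1 + g • M.Sigma2
  have hH : IsUnit H.det := by
    refine (Matrix.isUnit_iff_isUnit_det _).1 (isUnit_of_dotProduct_mulVec_pos fun x hx => ?_)
    have h1 := M.Sigma1_pos x hx
    have h2 := M.Sigma2_le_Sigma1 x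
    simp only [H, add_mulVec, dotProduct_add, smul_mulVec, dotProduct_smul, smul_eq_mul]
    nlinarith
  have hQ : M.quadCoeff γ = (2 : ℝ) • (M.Sigma2 * M.Sigma1⁻¹ * H) := by
    have h1 : M.Sigma2 * M.Sigma1⁻¹ * M.Sigma1 = M.Sigma2 := by
      rw [Matrix.mul_assoc, nonsing_inv_mul _ M.isUnit_det_Sigma1, Matrix.mul_one]
    rw [quadCoeff, transpose_Sigma2, Sigma3_eq_Sigma2, Matrix.mul_add, h1, Matrix.mul_smul,
      smul_add, smul_smul, add_comm, mul_div_assoc]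
  refine ⟨(-(g / 2)) • (H⁻¹ * M.delta), ?_⟩
  have h2 : M.Sigma2 * M.Sigma1⁻¹ * H * (H⁻¹ * M.delta) = M.Sigma2 * M.Sigma1⁻¹ * M.delta := by
    rw [Matrix.mul_assoc _ H, ← Matrix.mul_assoc H, mul_nonsing_inv _ hH, Matrix.one_mul]
  rw [hQ, Matrix.mul_smul, Matrix.smul_mul, h2, smul_smul, linCoeff, transpose_Sigma2, ← hgdef,
    add_right_comm, ← add_smul]
  have h3 : g + -(g / 2) * 2 = 0 := by ring
  rw [h3, zero_smul, zero_add, delta]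

theorem transpose_linCoeff (γ : ℝ) :
    (M.linCoeff γ)ᵀ = (γ / (1 - γ)) • (M.delta * M.Sigma1⁻¹ * M.Sigma2) + M.delta := by
  simp only [linCoeff, delta, transpose_add, transpose_smul, transpose_mul, transpose_inv_Sigma1,
    diagonal_transpose, transpose_transpose, Matrix.mul_assoc]

theorem riccatiRHS_neg (γ : ℝ) (Y : Matrix (Fin d) (Fin d) ℝ) :
    M.riccatiRHS γ (-Y) = riccatiField (M.constCoeff γ) (M.quadCoeff γ) (M.linCoeff γ) Y := by
  rw [riccatiRHS, riccatiField, ← quadCoeff, ← linCoeff, constCoeff]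
  noncomm_ring

theorem coeffR_neg (γ : ℝ) (Y : Matrix (Fin d) (Fin d) ℝ) :
    M.coeffR γ (-Y) = Y * M.quadCoeff γ + (M.linCoeff γ)ᵀ := by
  rw [coeffR, ← quadCoeff, transpose_linCoeff, Matrix.neg_mul, neg_neg]

theorem exists_forcing_neg (γ : ℝ) :
    ∃ v w : Fin d → ℝ, ∀ Y, M.forcing γ (-Y) = Y *ᵥ v + w :=
  ⟨_, _, fun Y => by rw [forcing, neg_mulVec, neg_neg]⟩

theorem exists_isSolution (hγ : γ < 0) (T : ℝ) :
    ∃ (C : ℝ → Matrix (Fin d) (Fin d) ℝ) (b : ℝ → Fin d → ℝ), M.IsSolution γ T C b := by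
  obtain ⟨Y, hY⟩ := exists_isRiccatiSolution (M.isRiccatiCost hγ) (M.linCoeff γ)
  obtain ⟨v, w, hvw⟩ := M.exists_forcing_neg γ
  obtain ⟨B, hB0, hB⟩ := hY.exists_linear_solution (M.isRiccatiCost hγ) v w
  refine ⟨fun t => -Y (T - t), fun t => B (T - t), by simp [hY.zero], by simp [hB0],
    fun t ht i j => ?_, fun t ht i => ?_⟩
  · rw [riccatiRHS_neg]
    simpa using (hasDerivWithinAt_reflect_symm (hY.deriv _ (sub_nonneg.2 ht) i j)).fun_neg
  · rw [coeffR_neg, hvw]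
    simpa using hasDerivWithinAt_reflect_symm (hB _ (sub_nonneg.2 ht) i)

namespace IsSolution

variable {M} {T : ℝ} {C : ℝ → Matrix (Fin d) (Fin d) ℝ} {b : ℝ → Fin d → ℝ}

theorem isRiccatiSolution (h : M.IsSolution γ T C b) :
    IsRiccatiSolution (M.constCoeff γ) (M.quadCoeff γ) (M.linCoeff γ) fun s => -C (T - s) := by
  refine ⟨by simp [h.terminal_C], fun s hs i j => ?_⟩
  rw [← riccatiRHS_neg, neg_neg]
  simpa using (hasDerivWithinAt_reflect (h.ode_C _ (sub_le_self T hs) i j)).fun_neg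

end IsSolution

end CointegratedMarket

/-! ### Assembly of the main theorem. -/

theorem mainTheorem4 {d m : ℕ} (M : CointegratedMarket d m) (γ : ℝ) (hγ : γ < 0) (T : ℝ) :
    (∃ (C : ℝ → Matrix (Fin d) (Fin d) ℝ) (b : ℝ → Fin d → ℝ), M.IsSolution γ T C b) ∧
    ∀ (C : ℝ → Matrix (Fin d) (Fin d) ℝ) (b : ℝ → Fin d → ℝ), M.IsSolution γ T C b →
      (∃ tstar : ℝ, tstar ≤ T ∧ ∀ t < tstar, AllEigenvaluesPositive (M.coeffR γ (C t))) ∧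
      ∃ bbar : Fin d → ℝ, Tendsto b atBot (𝓝 bbar) := by
  refine ⟨M.exists_isSolution hγ T, fun C b h => ?_⟩
  have hPQ := M.isRiccatiCost hγ
  obtain ⟨N, hN⟩ := M.exists_linCoeff_add_quadCoeff_mul hγ
  obtain ⟨L, hlim, hsym, hpos, hL⟩ :=
    h.isRiccatiSolution.exists_limit hPQ M.speed_pos hN
  have hGsym : (L⁻¹)ᵀ = L⁻¹ := by rw [transpose_nonsing_inv, hsym]
  have hG := dotProduct_inv_mulVec_pos hpos
  have hGR := dotProduct_inv_mul_mulVec_pos hPQ hsym hpos hL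
  have hR : ∀ s, M.coeffR γ (C (T - s)) = -C (T - s) * M.quadCoeff γ + (M.linCoeff γ)ᵀ :=
    fun s => by rw [← M.coeffR_neg, neg_neg]
  have hRlim : Tendsto (fun s => M.coeffR γ (C (T - s))) atTop
      (𝓝 (L * M.quadCoeff γ + (M.linCoeff γ)ᵀ)) := by
    have hc : Continuous fun Y => Y * M.quadCoeff γ + (M.linCoeff γ)ᵀ := by fun_prop
    simp only [hR]
    exact (hc.tendsto L).comp hlim
  have hrefl : Tendsto (fun t => T - t) atBot atTop :=
    tendsto_atTop_add_const_left _ T tendsto_neg_atBot_atTop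
  constructor
  -- The fixed matrix `L⁻¹` serves as Lyapunov matrix for all late `s`, positivity of the limit form
  -- being stable under small perturbations.
  · obtain ⟨c, hc, hev⟩ := exists_pos_eventually_le_dotProduct_mulVec hGR
      (H := fun s => L⁻¹ * M.coeffR γ (C (T - s))) (l := atTop)
      (((continuous_const.matrix_mul continuous_id).tendsto _).comp hRlim)
    obtain ⟨t₀, ht₀⟩ := eventually_atBot.1 (hrefl.eventually hev)
    refine ⟨min t₀ T, min_le_right _ _, fun t ht z hz => ?_⟩
    refine re_pos_of_hasEigenvalue hGsym hG (fun x hx => ?_) hz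
    have h1 := ht₀ t (ht.le.trans (min_le_left _ _)) x
    rw [sub_sub_cancel] at h1
    have hxx : 0 < x ⬝ᵥ x := by simpa using dotProduct_star_self_pos_iff.2 hx
    exact (mul_pos hc hxx).trans_le h1
  · obtain ⟨v, w, hvw⟩ := M.exists_forcing_neg γ
    have hflim : Tendsto (fun s => M.forcing γ (C (T - s))) atTop (𝓝 (L *ᵥ v + w)) := by
      have hc : Continuous fun Y : Matrix (Fin d) (Fin d) ℝ => Y *ᵥ v + w := by fun_prop
      refine ((hc.tendsto L).comp hlim).congr fun s => ?_
      simp [← hvw]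
    obtain ⟨bbar, hb⟩ := exists_tendsto_of_linear_ode (B := fun s => b (T - s)) hGsym hG hGR hRlim
      hflim fun s hs i =>
        hasDerivWithinAt_reflect (h.ode_b _ (sub_le_self T hs) i)
    refine ⟨bbar, (hb.comp hrefl).congr fun t => ?_⟩
    simp
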